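/- Let $(X,d)$ be a metric space and $\mu$ a Borel measure on $X$ such that every nonempty open set has positive measure and every bounded set has finite measure. Let $Q>0$ and suppose that $\mu$ is Ahlfors $Q$-regular, i.e. there are constants $c,C>0$ with $$c\,\operatorname{diam}(B)^Q\le \mu(B)\le C\,\operatorname{diam}(B)^Q\quad\text{for every ball } B\subset X \text{ with } \operatorname{diam} B\le 2\operatorname{diam}X,$$ and that $\mu$ is doubling, i.e. there is $C_D>0$ with $\mu(B(x,2r))\le C_D\,\mu(B(x,r))$ for every ball $B(x,r)=\{z: d(z,x)<r\}$. Then $\mu$ has no atoms: there is no Borel set $E$ with $\mu(E)>0$ such that every Borel set $F\subset E$ with $\mu(F)<\mu(E)$ satisfies $\mu(F)=0$. Moreover, let $p:X\to[1,\infty)$ be Borel measurable and let $L^{p(\cdot)}(X)$ be the space of (classes of $\mu$-a.e. equal) measurable functions $f:X\to\mathbb{R}$ such that $\rho(f/\eta)<\infty$ for some $\eta>0$, where $\rho(f)=\int_X|f(x)|^{p(x)}\,d\mu(x)$, with the norm $\|f\|_{p(\cdot)}=\inf\{\eta>0:\rho(f/\eta)\le 1\}$. Let $\varphi:X\to X$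 be a Borel map that is non-singular, i.e. $\mu(\varphi^{-1}(E))=0$ for every Borel set $E$ with $\mu(E)=0$. If the composition operator $C_\varphi f=f\circ\varphi$ is a bounded operator from $L^{p(\cdot)}(X)$ to itself and $C_\varphi\ne 0$, then $C_\varphi$ is not compact. -/

import Mathlib

open MeasureTheory Metric
open scoped ENNReal NNReal

/-! ### Metric measure spaces -/

/-- The standing assumptions on a Borel measure on a metric space: nonempty open sets have positive
measure and bounded sets have finite measure. -/
structure IsMetricMeasure {X : Type*} [MetricSpace X] [MeasurableSpace X] (μ : Measure X) :
    Prop where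
  pos_of_isOpen : ∀ U : Set X, IsOpen U → U.Nonempty → 0 < μ U
  finite_of_isBounded : ∀ A : Set X, Bornology.IsBounded A → μ A < ∞

/-- The doubling condition `μ(B(x,2r)) ≤ C μ(B(x,r))` for every (open) ball. -/
def IsDoublingMeasure {X : Type*} [MetricSpace X] [MeasurableSpace X] (μ : Measure X) : Prop :=
  ∃ C : ℝ≥0, 0 < C ∧ ∀ (x : X) (r : ℝ), 0 < r → μ (ball x (2 * r)) ≤ C * μ (ball x r)

/-- The bound `μ(B) ≤ C diam(B)^Q` for every ball `B` with `diam B ≤ 2 diam X`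
(diameters are `[0,∞]`-valued, so that unbounded `X` has infinite diameter). -/
def IsLowerAhlforsRegular {X : Type*} [MetricSpace X] [MeasurableSpace X] (Q : ℝ)
    (μ : Measure X) : Prop :=
  ∃ C : ℝ≥0, 0 < C ∧ ∀ (x : X) (r : ℝ), 0 < r →
    ediam (ball x r) ≤ 2 * ediam (Set.univ : Set X) → μ (ball x r) ≤ C * ediam (ball x r) ^ Q

/-- The bound `μ(B) ≥ C diam(B)^Q` for every ball `B` with `diam B ≤ 2 diam X`. -/
def IsUpperAhlforsRegular {X : Type*} [MetricSpace X] [MeasurableSpace X] (Q : ℝ)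
    (μ : Measure X) : Prop :=
  ∃ C : ℝ≥0, 0 < C ∧ ∀ (x : X) (r : ℝ), 0 < r →
    ediam (ball x r) ≤ 2 * ediam (Set.univ : Set X) → C * ediam (ball x r) ^ Q ≤ μ (ball x r)

/-- Ahlfors `Q`-regularity: both bounds hold. -/
def IsAhlforsRegular {X : Type*} [MetricSpace X] [MeasurableSpace X] (Q : ℝ)
    (μ : Measure X) : Prop :=
  IsLowerAhlforsRegular Q μ ∧ IsUpperAhlforsRegular Q μ

/-- An atom of `μ`: a measurable set of positive measure all of whose measurable subsets of
strictly smaller measure are null. -/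
def IsMeasureAtom {X : Type*} [MeasurableSpace X] (μ : Measure X) (E : Set X) : Prop :=
  MeasurableSet E ∧ 0 < μ E ∧ ∀ F : Set X, MeasurableSet F → F ⊆ E → μ F < μ E → μ F = 0

/-! ### Variable exponent Lebesgue spaces -/

/-- A variable exponent: a measurable function `p : X → [1, ∞)`, possibly unbounded. -/
structure VarExponent (X : Type*) [MeasurableSpace X] where
  toFun : X → ℝ
  measurable : Measurable toFun
  one_le : ∀ x, 1 ≤ toFun x

/-- The modular `ρ(f) = ∫ |f(x)|^{p(x)} dμ(x)`, with values in `[0,∞]`. -/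
noncomputable def modular {X : Type*} [MeasurableSpace X] (p : VarExponent X) (μ : Measure X)
    (f : X → ℝ) : ℝ≥0∞ :=
  ∫⁻ x, ‖f x‖ₑ ^ p.toFun x ∂μ

/-- The Luxemburg--Nakano norm `inf {η > 0 : ρ(f / η) ≤ 1}`. -/
noncomputable def luxemburgNorm {X : Type*} [MeasurableSpace X] (p : VarExponent X)
    (μ : Measure X) (f : X → ℝ) : ℝ :=
  sInf {η : ℝ | 0 < η ∧ modular p μ (fun x => f x / η) ≤ 1}

section Modular

variable {X : Type*} [MeasurableSpace X] {p : VarExponent X} {μ : Measure X}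

theorem modular_congr {f g : X → ℝ} (h : f =ᵐ[μ] g) : modular p μ f = modular p μ g := by
  refine lintegral_congr_ae ?_
  filter_upwards [h] with x hx
  rw [hx]

theorem modular_mul_le {f : X → ℝ} {k : ℝ} (hk0 : 0 ≤ k) (hk1 : k ≤ 1) :
    modular p μ (fun x => k * f x) ≤ ENNReal.ofReal k * modular p μ f := by
  unfold modular
  rw [← lintegral_const_mul' _ _ ENNReal.ofReal_ne_top]
  refine lintegral_mono fun x => ?_
  have hp := p.one_le x
  rw [enorm_mul, ENNReal.mul_rpow_of_nonneg _ _ (by linarith)]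
  gcongr
  rw [Real.enorm_eq_ofReal hk0]
  calc ENNReal.ofReal k ^ p.toFun x ≤ ENNReal.ofReal k ^ (1 : ℝ) :=
        ENNReal.rpow_le_rpow_of_exponent_ge (by simpa using hk1) hp
    _ = _ := by simp

theorem modular_add_le {f g : X → ℝ} (hf : AEMeasurable f μ) {a b : ℝ} (ha : 0 < a) (hb : 0 < b)
    (h1 : modular p μ (fun x => f x / a) ≤ 1) (h2 : modular p μ (fun x => g x / b) ≤ 1) :
    modular p μ (fun x => (f x + g x) / (a + b)) ≤ 1 := by
  have hab : 0 < a + b := by linarith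
  have hw : ENNReal.ofReal (a / (a + b)) + ENNReal.ofReal (b / (a + b)) = 1 := by
    rw [← ENNReal.ofReal_add (by positivity) (by positivity), ← add_div, div_self hab.ne']
    simp
  calc modular p μ (fun x => (f x + g x) / (a + b))
      ≤ ∫⁻ x, (ENNReal.ofReal (a / (a + b)) * ‖f x / a‖ₑ ^ p.toFun x
          + ENNReal.ofReal (b / (a + b)) * ‖g x / b‖ₑ ^ p.toFun x) ∂μ := by
        refine lintegral_mono fun x => ?_
        have hp := p.one_le x
        refine le_trans ?_ (ENNReal.rpow_arith_mean_le_arith_mean2_rpow _ _ _ _ hw hp)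
        refine ENNReal.rpow_le_rpow ?_ (by linarith)
        have e : (f x + g x) / (a + b) = a / (a + b) * (f x / a) + b / (a + b) * (g x / b) := by
          field_simp
        beta_reduce
        rw [e]
        refine (enorm_add_le _ _).trans ?_
        rw [enorm_mul, enorm_mul, Real.enorm_eq_ofReal (by positivity : 0 ≤ a / (a + b)),
          Real.enorm_eq_ofReal (by positivity : 0 ≤ b / (a + b))]
    _ = ENNReal.ofReal (a / (a + b)) * modular p μ (fun x => f x / a)
          + ENNReal.ofReal (b / (a + b)) * modular p μ (fun x => g x / b) := by
        rw [lintegral_add_left', lintegral_const_mul' _ _ ENNReal.ofReal_ne_top,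
          lintegral_const_mul' _ _ ENNReal.ofReal_ne_top]
        · rfl
        · exact (((hf.div_const a).enorm.pow p.measurable.aemeasurable)).const_mul _
    _ ≤ ENNReal.ofReal (a / (a + b)) * 1 + ENNReal.ofReal (b / (a + b)) * 1 := by gcongr
    _ = 1 := by simpa using hw

theorem exists_modular_le_one {f : X → ℝ}
    (h : ∃ η : ℝ, 0 < η ∧ modular p μ (fun x => f x / η) < ∞) :
    ∃ η : ℝ, 0 < η ∧ modular p μ (fun x => f x / η) ≤ 1 := by
  obtain ⟨η, hη, hf⟩ := h
  set R := (modular p μ (fun x => f x / η)).toReal with hR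
  have hR0 : 0 ≤ R := ENNReal.toReal_nonneg
  have hRe : modular p μ (fun x => f x / η) = ENNReal.ofReal R := (ENNReal.ofReal_toReal hf.ne).symm
  refine ⟨(1 + R) * η, by positivity, ?_⟩
  have e : (fun x => f x / ((1 + R) * η)) = fun x => (1 + R)⁻¹ * (f x / η) := by
    funext x
    field_simp
  rw [e]
  refine (modular_mul_le (by positivity) (inv_le_one_of_one_le₀ (by linarith))).trans ?_
  rw [hRe, ← ENNReal.ofReal_mul (by positivity), ENNReal.ofReal_le_one,
    inv_mul_le_one₀ (by positivity)]
  linarith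

end Modular

/-- The space `L^{p(·)}(X)`: (classes of) measurable functions `f` with `ρ(f / η) < ∞` for some
`η > 0`. -/
noncomputable def VarLp {X : Type*} [MeasurableSpace X] (p : VarExponent X) (μ : Measure X) :
    Submodule ℝ (X →ₘ[μ] ℝ) where
  carrier := {f | ∃ η : ℝ, 0 < η ∧ modular p μ (fun x => f x / η) < ∞}
  zero_mem' := by
    refine ⟨1, one_pos, ?_⟩
    have : modular p μ (fun x => (0 : X →ₘ[μ] ℝ) x / 1) = modular p μ (fun _ => 0) := by
      refine modular_congr ?_
      filter_upwards [AEEqFun.coeFn_zero (μ := μ) (β := ℝ)] with x hx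
      simp [hx]
    rw [this]
    have h0 : ∀ x, (0 : ℝ≥0∞) ^ p.toFun x = 0 := fun x =>
      ENNReal.zero_rpow_of_pos (by linarith [p.one_le x])
    simp [modular, h0]
  add_mem' := by
    intro f g hf hg
    obtain ⟨a, ha, hfa⟩ := exists_modular_le_one hf
    obtain ⟨b, hb, hgb⟩ := exists_modular_le_one hg
    refine ⟨a + b, by positivity, ?_⟩
    refine lt_of_le_of_lt (le_of_eq_of_le (modular_congr ?_)
      (modular_add_le f.aestronglyMeasurable.aemeasurable ha hb hfa hgb)) ENNReal.one_lt_top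
    filter_upwards [AEEqFun.coeFn_add f g] with x hx
    simp [hx]
  smul_mem' := by
    intro c f hf
    obtain ⟨a, ha, hfa⟩ := hf
    refine ⟨(1 + |c|) * a, by positivity, lt_of_le_of_lt ?_ hfa⟩
    refine lintegral_mono_ae ?_
    filter_upwards [AEEqFun.coeFn_smul c f] with x hx
    refine ENNReal.rpow_le_rpow ?_ (by linarith [p.one_le x])
    rw [hx, enorm_le_iff_norm_le]
    simp only [Pi.smul_apply, smul_eq_mul, Real.norm_eq_abs, abs_div, abs_mul, abs_of_pos ha]
    rw [abs_of_pos (by positivity : 0 < 1 + |c|), mul_div_mul_comm]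
    refine mul_le_of_le_one_left (by positivity) ?_
    rw [div_le_one (by positivity)]
    linarith

namespace VarLp

variable {X : Type*} [MeasurableSpace X] {p : VarExponent X} {μ : Measure X}

noncomputable instance instNorm : Norm (VarLp p μ) :=
  ⟨fun f => luxemburgNorm p μ ((f : X →ₘ[μ] ℝ) : X → ℝ)⟩

theorem norm_def (f : VarLp p μ) : ‖f‖ = luxemburgNorm p μ ((f : X →ₘ[μ] ℝ) : X → ℝ) := rfl

theorem norm_le_of_modular_le (f : VarLp p μ) {η : ℝ} (hη : 0 < η)
    (h : modular p μ (fun x => (f : X →ₘ[μ] ℝ) x / η) ≤ 1) : ‖f‖ ≤ η :=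
  csInf_le ⟨0, fun _ hx => hx.1.le⟩ ⟨hη, h⟩

theorem exists_lt_of_norm_lt (f : VarLp p μ) {r : ℝ} (h : ‖f‖ < r) :
    ∃ η : ℝ, 0 < η ∧ modular p μ (fun x => (f : X →ₘ[μ] ℝ) x / η) ≤ 1 ∧ η < r := by
  obtain ⟨η, ⟨h1, h2⟩, h3⟩ := exists_lt_of_csInf_lt (exists_modular_le_one f.2) h
  exact ⟨η, h1, h2, h3⟩

theorem norm_nonneg' (f : VarLp p μ) : 0 ≤ ‖f‖ := Real.sInf_nonneg fun _ hx => hx.1.le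

theorem norm_add_le' (f g : VarLp p μ) : ‖f + g‖ ≤ ‖f‖ + ‖g‖ := by
  refine le_of_forall_pos_le_add fun ε hε => ?_
  obtain ⟨a, ha, hfa, ha'⟩ := exists_lt_of_norm_lt f (lt_add_of_pos_right ‖f‖ (half_pos hε))
  obtain ⟨b, hb, hgb, hb'⟩ := exists_lt_of_norm_lt g (lt_add_of_pos_right ‖g‖ (half_pos hε))
  have : ‖f + g‖ ≤ a + b := by
    refine norm_le_of_modular_le _ (by positivity) (le_of_eq_of_le (modular_congr ?_)
      (modular_add_le (f : X →ₘ[μ] ℝ).aestronglyMeasurable.aemeasurable ha hb hfa hgb))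
    filter_upwards [AEEqFun.coeFn_add (f : X →ₘ[μ] ℝ) (g : X →ₘ[μ] ℝ)] with x hx
    simp [hx]
  linarith

theorem norm_smul_le' (c : ℝ) (hc : c ≠ 0) (f : VarLp p μ) : ‖c • f‖ ≤ |c| * ‖f‖ := by
  have hc' : 0 < |c| := abs_pos.2 hc
  rw [← div_le_iff₀' hc']
  refine le_of_forall_gt_imp_ge_of_dense fun r hr => ?_
  obtain ⟨a, ha, hfa, ha'⟩ := exists_lt_of_norm_lt f hr
  rw [div_le_iff₀' hc']
  refine (norm_le_of_modular_le (c • f) (η := |c| * a) (by positivity) ?_).trans (by gcongr)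
  refine le_of_eq_of_le ?_ hfa
  refine lintegral_congr_ae ?_
  filter_upwards [AEEqFun.coeFn_smul c (f : X →ₘ[μ] ℝ)] with x hx
  have hx' : ((c • f : VarLp p μ) : X →ₘ[μ] ℝ) x = c * (f : X →ₘ[μ] ℝ) x := by
    simpa using hx
  rw [hx']
  congr 1
  rw [enorm_eq_iff_norm_eq]
  simp only [Real.norm_eq_abs, abs_div, abs_mul, abs_abs]
  field_simp

theorem norm_zero' : ‖(0 : VarLp p μ)‖ = 0 := by
  refine le_antisymm (le_of_forall_pos_le_add fun ε hε => ?_) (norm_nonneg' _)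
  rw [zero_add]
  refine norm_le_of_modular_le _ hε ?_
  have : modular p μ (fun x => ((0 : VarLp p μ) : X →ₘ[μ] ℝ) x / ε) = modular p μ (fun _ => 0) := by
    refine modular_congr ?_
    filter_upwards [AEEqFun.coeFn_zero (μ := μ) (β := ℝ)] with x hx
    simp [hx]
  rw [this]
  have h0 : ∀ x, (0 : ℝ≥0∞) ^ p.toFun x = 0 := fun x =>
    ENNReal.zero_rpow_of_pos (by linarith [p.one_le x])
  simp [modular, h0]

theorem eq_zero_of_norm_eq_zero (f : VarLp p μ) (hf : ‖f‖ = 0) : f = 0 := by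
  have key : ∀ ε : ℝ, 0 < ε → ε ≤ 1 → modular p μ (f : X →ₘ[μ] ℝ) ≤ ENNReal.ofReal ε := by
    intro ε hε hε1
    obtain ⟨a, ha, hfa, ha'⟩ := exists_lt_of_norm_lt f (hf.trans_lt hε)
    have e : ((f : X →ₘ[μ] ℝ) : X → ℝ) = fun x => a * ((f : X →ₘ[μ] ℝ) x / a) := by
      funext x
      field_simp
    rw [e]
    refine (modular_mul_le ha.le (by linarith)).trans ?_
    calc _ ≤ ENNReal.ofReal a * 1 := by gcongr
      _ ≤ ENNReal.ofReal ε := by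
        rw [mul_one]
        exact ENNReal.ofReal_le_ofReal ha'.le
  have h0 : modular p μ (f : X →ₘ[μ] ℝ) = 0 := by
    refine le_antisymm (ENNReal.le_of_forall_pos_le_add fun ε hε _ => ?_) zero_le
    refine (key (min ε 1) (by positivity) (min_le_right _ _)).trans ?_
    rw [zero_add, ← ENNReal.ofReal_coe_nnreal]
    exact ENNReal.ofReal_le_ofReal (min_le_left _ _)
  have hm : AEMeasurable (fun x => ‖(f : X →ₘ[μ] ℝ) x‖ₑ ^ p.toFun x) μ :=
    (f : X →ₘ[μ] ℝ).aestronglyMeasurable.aemeasurable.enorm.pow p.measurable.aemeasurable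
  have h1 := (lintegral_eq_zero_iff' hm).1 h0
  refine Subtype.ext (AEEqFun.ext ?_)
  filter_upwards [h1, AEEqFun.coeFn_zero (μ := μ) (β := ℝ)] with x hx h0x
  have hp := p.one_le x
  have : (f : X →ₘ[μ] ℝ) x = 0 := by
    have hx' : ‖(f : X →ₘ[μ] ℝ) x‖ₑ ^ p.toFun x = 0 := hx
    rw [ENNReal.rpow_eq_zero_iff_of_pos (by linarith)] at hx'
    simpa using hx'
  rw [this]
  exact h0x.symm

theorem normCore : NormedSpace.Core ℝ (VarLp p μ) where
  norm_nonneg := norm_nonneg'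
  norm_triangle := norm_add_le'
  norm_eq_zero_iff f := ⟨eq_zero_of_norm_eq_zero f, fun h => h ▸ norm_zero'⟩
  norm_smul c f := by
    by_cases hc : c = 0
    · subst hc
      rw [zero_smul, norm_zero', norm_zero, zero_mul]
    · refine le_antisymm (norm_smul_le' c hc f) ?_
      have h := norm_smul_le' c⁻¹ (inv_ne_zero hc) (c • f)
      rw [inv_smul_smul₀ hc, abs_inv, inv_mul_eq_div, le_div_iff₀' (abs_pos.2 hc)] at h
      exact h

/-- `L^{p(·)}(X)` with the Luxemburg--Nakano norm. -/
noncomputable instance instNormedAddCommGroup : NormedAddCommGroup (VarLp p μ) :=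
  NormedAddCommGroup.ofCore normCore

noncomputable instance instNormedSpace : NormedSpace ℝ (VarLp p μ) :=
  NormedSpace.ofCore normCore

end VarLp

/-! ### Composition operators -/

/-- The bounded operator `T` on `L^{p(·)}(X)` is the composition operator `C_φ : f ↦ f ∘ φ`.
The map `φ` is non-singular: it is measurable and preimages of null sets are null, which is
`Measure.QuasiMeasurePreserving φ μ μ`, and makes `f ∘ φ` well defined on classes. -/
def IsCompositionOperator {X : Type*} [MeasurableSpace X] {p : VarExponent X} {μ : Measure X}
    (φ : X → X) (hφ : Measure.QuasiMeasurePreserving φ μ μ) (T : VarLp p μ →L[ℝ] VarLp p μ) :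
    Prop :=
  ∀ f : VarLp p μ, (T f : X →ₘ[μ] ℝ) = (f : X →ₘ[μ] ℝ).compQuasiMeasurePreserving φ hφ

/-! The bound `μ(B) ≤ C diam(B)^Q` makes small balls uniformly small in measure. Since `X` is
separable, an atom is covered by countably many balls of measure below its own; each meets it in a
null set, so it would be null.

For non-compactness, take a ball `A` with `μ(φ⁻¹ A) > 0` and push a finite piece of `μ` on `φ⁻¹ A`
forward to a measure `ν` on `A`; non-singularity keeps `ν` free of point masses. Indicators of
subsets of `A` are bounded in norm, so a compact `T` would give their images a finite net `T
1_{E_i}`. A diffuse measure admits `S ⊆ A` halving all `E_i` and `A` at once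
(`exists_subset_measureReal_symmDiff_eq_half`), so `ν(S ∆ E_i) = ν(A)/2` for every `i`. As `|T 1_S -
T 1_{E_i}| ≥ 1` on `φ⁻¹(S ∆ E_i)`, `T 1_S` stays away from the whole net
(`VarLp.measure_le_of_norm_lt`). -/

/-! ### σ-finiteness and separability -/

theorem IsMetricMeasure.sigmaFinite {X : Type*} [MetricSpace X] [MeasurableSpace X]
    [BorelSpace X] {μ : Measure X} (hμ : IsMetricMeasure μ) : SigmaFinite μ := by
  rcases isEmpty_or_nonempty X with h | ⟨⟨x⟩⟩
  · rw [Measure.eq_zero_of_isEmpty μ]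
    infer_instance
  · exact ⟨⟨{ set := fun n : ℕ => ball x n
              set_mem := fun _ => trivial
              finite := fun n => hμ.finite_of_isBounded _ isBounded_ball
              spanning := iUnion_ball_nat x }⟩⟩

/-- The clause `N ⊆ Set.univ` puts maximality in the form from which `N` is seen to cover all of
`X`. -/
theorem exists_maximal_isSeparated {X : Type*} [PseudoEMetricSpace X] (ε : ℝ≥0∞) :
    ∃ N : Set X, Maximal (fun N => N ⊆ Set.univ ∧ IsSeparated ε N) N := by
  refine zorn_subset {N : Set X | N ⊆ Set.univ ∧ IsSeparated ε N} fun c hc hch => ?_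
  refine ⟨⋃₀ c, ⟨Set.subset_univ _, ?_⟩, fun s hs => Set.subset_sUnion_of_mem hs⟩
  exact (Set.pairwise_sUnion hch.directedOn).2 fun s hs => (hc hs).2

/-- Balls of radius `ε / 2` about an `ε`-separated set are disjoint and of positive measure, so
σ-finiteness makes the set countable; a maximal such set is an `ε`-net. -/
theorem IsMetricMeasure.secondCountableTopology {X : Type*} [MetricSpace X] [MeasurableSpace X]
    [BorelSpace X] {μ : Measure X} (hμ : IsMetricMeasure μ) : SecondCountableTopology X := by
  have := hμ.sigmaFinite
  refine secondCountable_of_almost_dense_set fun ε hε => ?_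
  obtain ⟨N, hN⟩ := exists_maximal_isSeparated (X := X) (ENNReal.ofReal ε)
  refine ⟨N, ?_, fun x => ?_⟩
  · have hcount := Measure.countable_meas_pos_of_disjoint_iUnion (μ := μ)
      (As := fun x : N => ball (x : X) (ε / 2)) (fun _ => measurableSet_ball) fun x y hxy => by
        refine ball_disjoint_ball ?_
        have h : ENNReal.ofReal ε < edist (x : X) y := hN.prop.2 x.2 y.2 (Subtype.coe_injective.ne hxy)
        rw [edist_dist, ENNReal.ofReal_lt_ofReal_iff_of_nonneg hε.le] at h
        linarith
    have huniv : {x : N | 0 < μ (ball (x : X) (ε / 2))} = Set.univ :=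
      Set.eq_univ_of_forall fun x =>
        hμ.pos_of_isOpen _ isOpen_ball ⟨x, mem_ball_self (half_pos hε)⟩
    rw [huniv, Set.countable_univ_iff] at hcount
    exact Set.countable_coe_iff.1 hcount
  · obtain ⟨y, hy, hxy⟩ := IsCover.of_maximal_isSeparated hN (Set.mem_univ x)
    refine ⟨y, hy, ?_⟩
    have hxy' : edist x y ≤ ENNReal.ofReal ε := hxy
    rwa [edist_dist, ENNReal.ofReal_le_ofReal_iff hε.le] at hxy'

/-! ### Small balls and absence of atoms -/

theorem IsLowerAhlforsRegular.exists_measure_ball_lt {X : Type*} [MetricSpace X]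
    [MeasurableSpace X] {μ : Measure X} {Q : ℝ} (hQ : 0 < Q) (hreg : IsLowerAhlforsRegular Q μ)
    {ε : ℝ≥0∞} (hε : 0 < ε) : ∃ r : ℝ, 0 < r ∧ ∀ x : X, μ (ball x r) < ε := by
  obtain ⟨C, -, hC⟩ := hreg
  have hlim : Filter.Tendsto (fun r : ℝ => (C : ℝ≥0∞) * (2 * ENNReal.ofReal r) ^ Q)
      (nhdsWithin 0 (Set.Ioi 0)) (nhds 0) := by
    have hcont : Continuous fun r : ℝ => (C : ℝ≥0∞) * (2 * ENNReal.ofReal r) ^ Q :=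
      (ENNReal.continuous_const_mul ENNReal.coe_ne_top).comp
        (ENNReal.continuous_rpow_const.comp
          ((ENNReal.continuous_const_mul (by simp)).comp ENNReal.continuous_ofReal))
    have h := hcont.tendsto 0
    simp only [ENNReal.ofReal_zero, mul_zero, ENNReal.zero_rpow_of_pos hQ] at h
    exact h.mono_left nhdsWithin_le_nhds
  obtain ⟨r, hr, hr0⟩ := ((hlim.eventually_lt_const hε).and self_mem_nhdsWithin).exists
  refine ⟨r, hr0, fun x => lt_of_le_of_lt ?_ hr⟩
  refine (hC x r hr0 ?_).trans ?_
  -- The restriction on diameters always holds, as `diam B ≤ diam X`.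
  · exact (ediam_mono (Set.subset_univ _)).trans (le_mul_of_one_le_left zero_le one_le_two)
  · gcongr
    rw [← eball_ofReal]
    exact ediam_eball_le

theorem IsLowerAhlforsRegular.nullSingletonClass {X : Type*} [MetricSpace X]
    [MeasurableSpace X] {μ : Measure X} {Q : ℝ} (hQ : 0 < Q)
    (hreg : IsLowerAhlforsRegular Q μ) : NullSingletonClass μ := by
  refine ⟨fun x => ?_⟩
  by_contra h
  obtain ⟨r, hr, hx⟩ := hreg.exists_measure_ball_lt hQ (pos_iff_ne_zero.2 h)
  exact (hx x).not_ge (measure_mono (Set.singleton_subset_iff.2 (mem_ball_self hr)))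

theorem IsLowerAhlforsRegular.not_isMeasureAtom {X : Type*} [MetricSpace X] [MeasurableSpace X]
    [BorelSpace X] [SecondCountableTopology X] {μ : Measure X} {Q : ℝ} (hQ : 0 < Q)
    (hreg : IsLowerAhlforsRegular Q μ) (E : Set X) : ¬ IsMeasureAtom μ E := by
  rintro ⟨hE, hpos, hatom⟩
  obtain ⟨r, hr, hball⟩ := hreg.exists_measure_ball_lt hQ hpos
  refine hpos.ne' ?_
  obtain ⟨s, hs, hsd⟩ := TopologicalSpace.exists_countable_dense X
  have hcov : E ⊆ ⋃ y ∈ s, E ∩ ball y r := fun x hx => by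
    obtain ⟨y, hy, hxy⟩ := hsd.exists_dist_lt x hr
    exact Set.mem_biUnion hy ⟨hx, hxy⟩
  refine measure_mono_null hcov ((measure_biUnion_null_iff hs).2 fun y _ => ?_)
  exact hatom _ (hE.inter measurableSet_ball) Set.inter_subset_left
    ((measure_mono Set.inter_subset_right).trans_lt (hball y))

/-! ### Halving sets for a diffuse measure -/

theorem exists_measurable_injective_real (X : Type*) [TopologicalSpace X] [T2Space X]
    [SecondCountableTopology X] [MeasurableSpace X] [BorelSpace X] :
    ∃ g : X → ℝ, Measurable g ∧ Function.Injective g := by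
  obtain ⟨f, hf, hinj⟩ := MeasurableSpace.measurable_injection_nat_bool_of_countablySeparated X
  have he := measurableEmbedding_embeddingReal (ℕ → Bool)
  exact ⟨_, he.measurable.comp hf, he.injective.comp hinj⟩

/-- Without point masses the distribution function is continuous, so the intermediate value theorem
applies. -/
theorem exists_measureReal_Iic_eq_half (θ : Measure ℝ) [IsFiniteMeasure θ]
    [NullSingletonClass θ] (hθ : θ ≠ 0) : ∃ t, θ.real (Set.Iic t) = θ.real Set.univ / 2 := by
  have hcont : Continuous fun t => θ.real (Set.Iic t) := by
    have h : Continuous fun t => ∫ _ in (0 : ℝ)..t, (1 : ℝ) ∂θ :=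
      intervalIntegral.continuous_primitive
        (fun _ _ => (integrable_const (1 : ℝ)).intervalIntegrable) 0
    have e : (fun t => θ.real (Set.Iic t))
        = fun t => θ.real (Set.Iic 0) + ∫ _ in (0 : ℝ)..t, (1 : ℝ) ∂θ := by
      funext t
      rw [← intervalIntegral.integral_Iic_sub_Iic (integrable_const _).integrableOn
        (integrable_const _).integrableOn]
      simp
    rw [e]
    exact continuous_const.add h
  have hpos : 0 < θ.real Set.univ := by
    rw [measureReal_def]
    exact ENNReal.toReal_pos (by simpa using hθ) (measure_ne_top _ _)
  have htop : Filter.Tendsto (fun t => θ.real (Set.Iic t)) Filter.atTop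
      (nhds (θ.real Set.univ)) :=
    (ENNReal.tendsto_toReal (measure_ne_top _ _)).comp (tendsto_measure_Iic_atTop θ)
  have hbot : Filter.Tendsto (fun t => θ.real (Set.Iic t)) Filter.atBot (nhds 0) := by
    have h := tendsto_measure_iInter_atBot (μ := θ) (s := fun t : ℝ => Set.Iic t)
      (fun _ => measurableSet_Iic.nullMeasurableSet) (fun _ _ h => Set.Iic_subset_Iic.2 h)
      ⟨0, measure_ne_top _ _⟩
    have hempty : ⋂ t : ℝ, Set.Iic t = ∅ := Set.eq_empty_of_forall_notMem fun x hx =>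
      (sub_one_lt x).not_ge (Set.mem_iInter.1 hx (x - 1))
    rw [hempty, measure_empty] at h
    exact (ENNReal.tendsto_toReal ENNReal.zero_ne_top).comp h
  obtain ⟨a, ha⟩ := (hbot.eventually_lt_const (half_pos hpos)).exists
  obtain ⟨b, hb⟩ := (htop.eventually_const_lt (half_lt_self hpos)).exists
  exact mem_range_of_exists_le_of_exists_ge hcont ⟨a, ha.le⟩ ⟨b, hb.le⟩

section Halving

variable {X : Type*} [TopologicalSpace X] [T2Space X] [SecondCountableTopology X]
  [MeasurableSpace X] [BorelSpace X] (ν : Measure X) [IsFiniteMeasure ν] [NullSingletonClass ν]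

theorem exists_subset_measureReal_eq_half {A : Set X} (hA : MeasurableSet A) :
    ∃ S ⊆ A, MeasurableSet S ∧ ν.real S = ν.real A / 2 := by
  obtain ⟨g, hg, hinj⟩ := exists_measurable_injective_real X
  by_cases h0 : ν A = 0
  · exact ⟨∅, Set.empty_subset _, .empty, by simp [measureReal_def, h0]⟩
  -- Injectivity of `g` makes its fibres have at most one point, so the image measure on `ℝ` is
  -- again diffuse.
  set θ := (ν.restrict A).map g
  have : NullSingletonClass θ := ⟨fun t => by
    rw [Measure.map_apply hg (measurableSet_singleton t)]
    exact (Set.subsingleton_singleton.preimage hinj).measure_zero _⟩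
  have huniv : θ Set.univ = ν A := by
    rw [Measure.map_apply hg .univ, Set.preimage_univ, Measure.restrict_apply_univ]
  have hθ : θ ≠ 0 := fun h => h0 (by rw [← huniv, h]; rfl)
  obtain ⟨t, ht⟩ := exists_measureReal_Iic_eq_half θ hθ
  refine ⟨g ⁻¹' Set.Iic t ∩ A, Set.inter_subset_right, (hg measurableSet_Iic).inter hA, ?_⟩
  rwa [measureReal_def, measureReal_def, huniv, Measure.map_apply hg measurableSet_Iic,
    Measure.restrict_apply (hg measurableSet_Iic)] at ht

/-- Induction on the list: the remaining sets are halved separately inside `A ∩ E` and `A \ E`, and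
the union of the two halves also halves `E`. -/
theorem exists_subset_measureReal_inter_eq_half (L : List (Set X))
    (hL : ∀ E ∈ L, MeasurableSet E) {A : Set X} (hA : MeasurableSet A) :
    ∃ S ⊆ A, MeasurableSet S ∧ ν.real S = ν.real A / 2 ∧
      ∀ E ∈ L, ν.real (S ∩ E) = ν.real (A ∩ E) / 2 := by
  induction L generalizing A with
  | nil =>
    obtain ⟨S, hSA, hS, h⟩ := exists_subset_measureReal_eq_half ν hA
    exact ⟨S, hSA, hS, h, by simp⟩
  | cons E L ih =>
    have hE : MeasurableSet E := hL E (by simp)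
    have hL' : ∀ F ∈ L, MeasurableSet F := fun F hF => hL F (by simp [hF])
    obtain ⟨S, hSA, hS, h, hSL⟩ := ih hL' (hA.inter hE)
    obtain ⟨R, hRA, hR, k, hRL⟩ := ih hL' (hA.diff hE)
    have hSE : S ⊆ E := hSA.trans Set.inter_subset_right
    have hRE : Disjoint R E := Set.disjoint_left.2 fun x hx => (hRA hx).2
    have hSR : Disjoint S R := (hRE.mono_right hSE).symm
    refine ⟨S ∪ R, Set.union_subset (hSA.trans Set.inter_subset_left)
      (hRA.trans Set.sdiff_subset), hS.union hR, ?_, fun F hF => ?_⟩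
    · rw [measureReal_union hSR hR, h, k, ← measureReal_inter_add_sdiff (s := A) hE]
      ring
    · rcases List.mem_cons.1 hF with rfl | hF
      · rw [Set.union_inter_distrib_right, hRE.inter_eq, Set.union_empty,
          Set.inter_eq_left.2 hSE, h]
      · rw [Set.union_inter_distrib_right, measureReal_union
          (hSR.mono Set.inter_subset_left Set.inter_subset_left) (hR.inter (hL' F hF)),
          hSL F hF, hRL F hF, ← measureReal_inter_add_sdiff (s := A ∩ F) hE, Set.inter_right_comm,
          Set.inter_sdiff_right_comm]
        ring

/-- If `S` halves both `A` and `E ⊆ A`, then `ν(S) + ν(E) - 2ν(S ∩ E) = ν(A)/2`, whatever the size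
of `E`. -/
theorem exists_subset_measureReal_symmDiff_eq_half (L : List (Set X))
    {A : Set X} (hL : ∀ E ∈ L, MeasurableSet E ∧ E ⊆ A) (hA : MeasurableSet A) :
    ∃ S ⊆ A, MeasurableSet S ∧ ∀ E ∈ L, ν.real (symmDiff S E) = ν.real A / 2 := by
  obtain ⟨S, hSA, hS, h, hSL⟩ :=
    exists_subset_measureReal_inter_eq_half ν L (fun E hE => (hL E hE).1) hA
  refine ⟨S, hSA, hS, fun E hE => ?_⟩
  obtain ⟨hEm, hEA⟩ := hL E hE
  have h1 := measureReal_inter_add_sdiff (μ := ν) (s := S) hEm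
  have h2 := measureReal_inter_add_sdiff (μ := ν) (s := E) hS
  have h3 := hSL E hE
  rw [Set.inter_eq_right.2 hEA] at h3
  rw [Set.inter_comm] at h2
  rw [measureReal_symmDiff_eq hS hEm]
  linarith

end Halving

/-! ### Indicators in the variable exponent space -/

section Indicator

variable {X : Type*} [MeasurableSpace X] {p : VarExponent X} {μ : Measure X}

theorem modular_indicator_one {E : Set X} (hE : MeasurableSet E) :
    modular p μ (E.indicator 1) = μ E := by
  rw [← lintegral_indicator_one hE]
  refine lintegral_congr fun x => ?_
  by_cases hx : x ∈ E
  · simp [hx]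
  · simp [hx, ENNReal.zero_rpow_of_pos (zero_lt_one.trans_le (p.one_le x))]

namespace VarLp

theorem exists_ae_eq_indicator {E : Set X} (hE : MeasurableSet E) (hμE : μ E < ∞) :
    ∃ u : VarLp p μ, (u : X →ₘ[μ] ℝ) =ᵐ[μ] E.indicator 1 := by
  have hm : AEStronglyMeasurable (E.indicator (1 : X → ℝ)) μ :=
    (stronglyMeasurable_one.indicator hE).aestronglyMeasurable
  refine ⟨⟨AEEqFun.mk _ hm, 1, one_pos, ?_⟩, AEEqFun.coeFn_mk _ hm⟩
  simp only [div_one]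
  rwa [modular_congr (AEEqFun.coeFn_mk _ hm), modular_indicator_one hE]

theorem norm_le_of_ae_eq_indicator {E A : Set X} (hE : MeasurableSet E) (hEA : E ⊆ A)
    (hμA : μ A < ∞) {u : VarLp p μ} (hu : (u : X →ₘ[μ] ℝ) =ᵐ[μ] E.indicator 1) :
    ‖u‖ ≤ 1 + μ.real A := by
  have h0 : 0 ≤ μ.real A := measureReal_nonneg
  refine norm_le_of_modular_le u (by positivity) ?_
  simp_rw [div_eq_inv_mul]
  refine (modular_mul_le (by positivity) (inv_le_one_of_one_le₀ (by linarith))).trans ?_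
  rw [modular_congr hu, modular_indicator_one hE]
  refine (mul_le_mul_right (measure_mono hEA) _).trans ?_
  rw [← ENNReal.ofReal_toReal hμA.ne, ← ENNReal.ofReal_mul (by positivity),
    ENNReal.ofReal_le_one, inv_mul_le_one₀ (by positivity)]
  exact le_add_of_nonneg_left zero_le_one

/-- A Chebyshev bound valid for unbounded `p`: for `η ≤ 1`, `ρ(f/η) ≤ 1` gives `ρ(f) ≤ η` because `p
≥ 1`, while `|f|^p ≥ 1` on `D`. -/
theorem measure_le_of_norm_lt {D : Set X} (hD : MeasurableSet D) {f : VarLp p μ}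
    (hf : ∀ᵐ x ∂μ, x ∈ D → 1 ≤ ‖(f : X →ₘ[μ] ℝ) x‖ₑ) {r : ℝ} (hr : r ≤ 1) (h : ‖f‖ < r) :
    μ D ≤ ENNReal.ofReal r := by
  obtain ⟨η, hη, hm, hηr⟩ := exists_lt_of_norm_lt f h
  calc μ D = ∫⁻ x, D.indicator 1 x ∂μ := (lintegral_indicator_one hD).symm
    _ ≤ modular p μ (f : X →ₘ[μ] ℝ) := by
      refine lintegral_mono_ae ?_
      filter_upwards [hf] with x hx
      by_cases hxD : x ∈ D
      · simpa [hxD] using ENNReal.one_le_rpow (hx hxD) (zero_lt_one.trans_le (p.one_le x))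
      · simp [hxD]
    _ = modular p μ (fun x => η * ((f : X →ₘ[μ] ℝ) x / η)) := by
      congr 1
      funext x
      field_simp
    _ ≤ ENNReal.ofReal η * modular p μ (fun x => (f : X →ₘ[μ] ℝ) x / η) :=
      modular_mul_le hη.le (by linarith)
    _ ≤ ENNReal.ofReal η * 1 := by gcongr
    _ ≤ ENNReal.ofReal r := by
      rw [mul_one]
      exact ENNReal.ofReal_le_ofReal hηr.le

end VarLp

theorem IsCompositionOperator.ae_one_le_enorm_sub {φ : X → X}
    {hφ : Measure.QuasiMeasurePreserving φ μ μ} {T : VarLp p μ →L[ℝ] VarLp p μ}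
    (hT : IsCompositionOperator φ hφ T) {u v : VarLp p μ} {S E : Set X}
    (hu : (u : X →ₘ[μ] ℝ) =ᵐ[μ] S.indicator 1) (hv : (v : X →ₘ[μ] ℝ) =ᵐ[μ] E.indicator 1) :
    ∀ᵐ x ∂μ, x ∈ φ ⁻¹' symmDiff S E → 1 ≤ ‖((T u - T v : VarLp p μ) : X →ₘ[μ] ℝ) x‖ₑ := by
  have key : ∀ {w : VarLp p μ} {F : Set X}, (w : X →ₘ[μ] ℝ) =ᵐ[μ] F.indicator 1 →
      ((T w : VarLp p μ) : X →ₘ[μ] ℝ) =ᵐ[μ] F.indicator 1 ∘ φ := fun {w F} hw => by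
    rw [hT w]
    exact ((w : X →ₘ[μ] ℝ).coeFn_compQuasiMeasurePreserving hφ).trans (hφ.ae_eq_comp hw)
  filter_upwards [key hu, key hv,
    AEEqFun.coeFn_sub ((T u : VarLp p μ) : X →ₘ[μ] ℝ) ((T v : VarLp p μ) : X →ₘ[μ] ℝ)]
    with x hxu hxv hx hxD
  have hx' : ((T u - T v : VarLp p μ) : X →ₘ[μ] ℝ) x
      = S.indicator 1 (φ x) - E.indicator 1 (φ x) := by
    rw [Submodule.coe_sub, hx, Pi.sub_apply, hxu, hxv]
    rfl
  rw [hx']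
  rcases Set.mem_symmDiff.1 (Set.mem_preimage.1 hxD) with ⟨h1, h2⟩ | ⟨h1, h2⟩ <;> simp [h1, h2]

end Indicator

/-! ### Non-compactness -/

theorem IsCompositionOperator.not_isCompactOperator {X : Type*} [TopologicalSpace X] [T2Space X]
    [SecondCountableTopology X] [MeasurableSpace X] [BorelSpace X] {μ : Measure X}
    [SigmaFinite μ] [NullSingletonClass μ] {p : VarExponent X} {φ : X → X}
    {hφ : Measure.QuasiMeasurePreserving φ μ μ} {T : VarLp p μ →L[ℝ] VarLp p μ}
    (hT : IsCompositionOperator φ hφ T) {A : Set X} (hA : MeasurableSet A) (hμA : μ A < ∞)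
    (hφA : 0 < μ (φ ⁻¹' A)) : ¬ IsCompactOperator T := by
  intro hcomp
  -- `φ⁻¹ A` may have infinite measure; restricting to `B` makes `ν` finite.
  obtain ⟨B, hB, hBA, hB0, hBtop⟩ :=
    Measure.exists_subset_measure_lt_top (hφ.measurable hA) hφA
  have : IsFiniteMeasure (μ.restrict B) := ⟨by rwa [Measure.restrict_apply_univ]⟩
  set ν := (μ.restrict B).map φ with hν
  have hνμ : ∀ E, MeasurableSet E → ν E ≤ μ (φ ⁻¹' E) := fun E hE => by
    rw [hν, Measure.map_apply hφ.measurable hE]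
    exact Measure.restrict_apply_le _ _
  have : NullSingletonClass ν := ⟨fun x => le_antisymm
    ((hνμ _ (measurableSet_singleton x)).trans
      (hφ.preimage_null (measure_singleton x)).le) zero_le⟩
  have hνA : 0 < ν.real A := by
    rw [measureReal_def, hν, Measure.map_apply hφ.measurable hA,
      Measure.restrict_apply (hφ.measurable hA), Set.inter_eq_right.2 hBA]
    exact ENNReal.toReal_pos hB0.ne' hBtop.ne
  set F : Set (VarLp p μ) := {w | ∃ S : Set X, ∃ u : VarLp p μ, MeasurableSet S ∧ S ⊆ A ∧
    (u : X →ₘ[μ] ℝ) =ᵐ[μ] S.indicator 1 ∧ T u = w}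
  have hF : TotallyBounded F := by
    obtain ⟨K, hK, hTK⟩ := hcomp.image_closedBall_subset_compact (f := T.toLinearMap)
      (1 + μ.real A)
    refine hK.totallyBounded.subset ?_
    rintro _ ⟨S, u, hS, hSA, hu, rfl⟩
    exact hTK ⟨u, mem_closedBall_zero_iff.2
      (VarLp.norm_le_of_ae_eq_indicator hS hSA hμA hu), rfl⟩
  -- The bound `1` is needed to pass from norm to measure; `ν(A)/4` lies strictly below the `ν(A)/2`
  -- of the symmetric differences.
  set ε := min 1 (ν.real A / 4)
  -- The net is taken inside `F`, so that its points are images of indicators.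
  obtain ⟨t, htF, htfin, hcov⟩ := finite_approx_of_totallyBounded hF ε (by positivity)
  have hnet : ∀ w ∈ t, ∃ S : Set X, ∃ u : VarLp p μ, MeasurableSet S ∧ S ⊆ A ∧
      (u : X →ₘ[μ] ℝ) =ᵐ[μ] S.indicator 1 ∧ T u = w := fun w hw => htF hw
  choose! E v hE hEA hv hTv using hnet
  have hL : ∀ D ∈ htfin.toFinset.toList.map E, MeasurableSet D ∧ D ⊆ A := fun D hD => by
    obtain ⟨w, hw, rfl⟩ := List.mem_map.1 hD
    have hw' : w ∈ t := by simpa using hw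
    exact ⟨hE w hw', hEA w hw'⟩
  obtain ⟨S, hSA, hS, hhalf⟩ := exists_subset_measureReal_symmDiff_eq_half ν _ hL hA
  obtain ⟨u, hu⟩ := VarLp.exists_ae_eq_indicator (p := p) hS ((measure_mono hSA).trans_lt hμA)
  obtain ⟨w, hw, hdist⟩ := Set.mem_iUnion₂.1 (hcov ⟨S, u, hS, hSA, hu, rfl⟩)
  rw [mem_ball, dist_eq_norm, ← hTv w hw] at hdist
  have hD : MeasurableSet (symmDiff S (E w)) := hS.symmDiff (hE w hw)
  have hle := (hνμ _ hD).trans (VarLp.measure_le_of_norm_lt (hφ.measurable hD)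
    (hT.ae_one_le_enorm_sub hu (hv w hw)) (min_le_left _ _) hdist)
  have hle' := ENNReal.toReal_le_of_le_ofReal (by positivity) hle
  have heq : ν.real (symmDiff S (E w)) = ν.real A / 2 :=
    hhalf _ (List.mem_map_of_mem (by simpa using hw))
  rw [← measureReal_def, heq] at hle'
  linarith [min_le_right 1 (ν.real A / 4)]

theorem theorem3p4 {X : Type*} [MetricSpace X] [MeasurableSpace X] [BorelSpace X]
    (μ : Measure X) (hμ : IsMetricMeasure μ) (Q : ℝ) (hQ : 0 < Q)
    (hreg : IsAhlforsRegular Q μ) (hdoub : IsDoublingMeasure μ) :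
    (∀ E : Set X, ¬ IsMeasureAtom μ E) ∧
    ∀ (p : VarExponent X) (φ : X → X) (hφ : Measure.QuasiMeasurePreserving φ μ μ)
      (T : VarLp p μ →L[ℝ] VarLp p μ), IsCompositionOperator φ hφ T → T ≠ 0 →
      ¬ IsCompactOperator T := by
  have := hμ.sigmaFinite
  have := hμ.secondCountableTopology
  have := hreg.1.nullSingletonClass hQ
  refine ⟨hreg.1.not_isMeasureAtom hQ, fun p φ hφ T hT hT0 => ?_⟩
  -- For `μ = 0` the space `L^{p(·)}` is trivial, which contradicts `T ≠ 0`.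
  have hX : μ ≠ 0 := by
    rintro rfl
    refine hT0 (ContinuousLinearMap.ext fun f => Subtype.ext (AEEqFun.ext ?_))
    simp [Filter.EventuallyEq]
  obtain ⟨x⟩ : Nonempty X := by
    by_contra h
    have := not_nonempty_iff.1 h
    exact hX (Measure.eq_zero_of_isEmpty μ)
  obtain ⟨n, hn⟩ : ∃ n : ℕ, 0 < μ (φ ⁻¹' ball x n) := by
    refine exists_measure_pos_of_not_measure_iUnion_null ?_
    rw [← Set.preimage_iUnion, iUnion_ball_nat, Set.preimage_univ]
    simpa using hX
  exact hT.not_isCompactOperator measurableSet_ball (hμ.finite_of_isBounded _ isBounded_ball) hn
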